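/- Theorem (Grätzer–Lakser–Schmidt). There is an absolute constant $C$ such that for every (nonempty) finite distributive lattice $D$ there exists a finite (nonempty) planar lattice $L$ whose congruence lattice $\operatorname{Con} L$, ordered by inclusion, is isomorphic to $D$, and such that $|L| \le C n^2$ whenever $n \ge 1$, where $n$ is the number of join-irreducible elements of $D$ (the least element is not counted as join-irreducible). Here a finite lattice is planar if it has a Hasse diagram in $\mathbb{R}^2$ (elements are distinct points, larger elements lie higher, covering pairs are joined by straight line segments) in which no element lies on a segment of which it is not an endpoint and two different segments meet only in common endpoints. -/

import Mathlib

/-- Lattice congruences are ordered by inclusion: `c ≤ d` if `x ≡ y (c)` implies `x ≡ y (d)`.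
With this order `LatticeCon L` is the congruence lattice `Con L`. -/
instance LatticeCon.instPartialOrder {L : Type*} [Lattice L] : PartialOrder (LatticeCon L) where
  le c d := ∀ ⦃x y : L⦄, c.r x y → d.r x y
  le_refl _ _ _ h := h
  le_trans _ _ _ h₁ h₂ _ _ h := h₂ (h₁ h)
  le_antisymm := by
    rintro ⟨⟨r, hr⟩, hi, hs⟩ ⟨⟨r', hr'⟩, hi', hs'⟩ h₁ h₂
    obtain rfl : r = r' := by
      funext x y
      exact propext ⟨fun h => h₁ h, fun h => h₂ h⟩
    rfl

/-- A placement `f` of the elements of an ordered set in the plane is a planar (Hasse) diagram: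
different elements are different points, larger elements lie higher, each covering pair is
joined by a straight line segment, no element lies on a segment of which it is not an endpoint,
and two different segments meet only in common endpoints. -/
structure IsPlanarDiagram {P : Type*} [PartialOrder P] (f : P → ℝ × ℝ) : Prop where
  injective : Function.Injective f
  upward : ∀ a b : P, a < b → (f a).2 < (f b).2
  vertex_edge : ∀ a b c : P, a ⋖ b → f c ∈ segment ℝ (f a) (f b) → c = a ∨ c = b
  edge_edge : ∀ a b c d : P, a ⋖ b → c ⋖ d → (a, b) ≠ (c, d) →
    segment ℝ (f a) (f b) ∩ segment ℝ (f c) (f d) ⊆ {f a, f b} ∩ {f c, f d}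

/-- A finite lattice is planar if it has a planar diagram. -/
def IsPlanarLattice (L : Type*) [Lattice L] : Prop :=
  Finite L ∧ ∃ f : L → ℝ × ℝ, IsPlanarDiagram f

/-- The number of join-irreducible elements (the least element is not join-irreducible). -/
noncomputable def numJoinIrred (D : Type*) [Lattice D] : ℕ :=
  Nat.card {a : D // SupIrred a}

/-! By Birkhoff's theorem `D` is the lattice of lower sets of its `n` join-irreducibles, here called
colours. Start from a grid with `2n` columns and `n` rows; column `k` has colour `k / 2` and row `j`
has colour `j`. A congruence of a grid is an arbitrary choice of columns and rows to collapse, so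
new elements are inserted to restrict that choice.

An element inside the cell of column `k` and row `k / 2` makes the cell an `M₃`, so column and row
are collapsed together. If `j ≤ i`, an element in row `j` on the vertical line between the two
columns of colour `i` forms a pentagon with the cell on its left, so collapsing `i` forces
collapsing `j`. No other constraint arises: `extends_gridCon` shows that every closed set of colours
gives a congruence, and `toCon_surjective` that there are no more. The size is quadratic because
there are `O(n²)` grid points and at most `4n²` new elements. Planarity follows from an order
embedding into the plane (`position_le_iff`). -/

/-! ### Planarity from order dimension at most two -/

/-- Two increasing segments with the same lower endpoint that meet elsewhere have comparable
upper endpoints. -/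
theorem le_or_le_of_mem_segment_left {u v w p : ℝ × ℝ} (huv : u ≤ v) (huw : u ≤ w)
    (hv : p ∈ segment ℝ u v) (hw : p ∈ segment ℝ u w) (hp : p ≠ u) : v ≤ w ∨ w ≤ v := by
  rw [segment_eq_image'] at hv hw
  obtain ⟨s, ⟨hs0, -⟩, rfl⟩ := hv
  obtain ⟨t, ⟨ht0, -⟩, ht⟩ := hw
  have hs : 0 < s := hs0.lt_of_ne (by rintro rfl; simp at hp)
  have ht' : 0 < t := ht0.lt_of_ne (by rintro rfl; simp_all)
  simp only [Prod.ext_iff, Prod.fst_add, Prod.snd_add, Prod.smul_fst, Prod.smul_snd, Prod.fst_sub,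
    Prod.snd_sub, smul_eq_mul] at ht
  -- Here `s (v - u) = t (w - u)` with `s, t > 0`, so comparing `s` with `t` compares `v` with `w`.
  obtain ⟨h1, h2⟩ := ht
  rw [Prod.le_def] at huv huw
  rcases le_total s t with hst | hst
  · right
    constructor
    · have := mul_le_mul_of_nonneg_right hst (sub_nonneg.2 huv.1)
      have : t * (w.1 - u.1) ≤ t * (v.1 - u.1) := by linarith
      linarith [le_of_mul_le_mul_left this ht']
    · have := mul_le_mul_of_nonneg_right hst (sub_nonneg.2 huv.2)
      have : t * (w.2 - u.2) ≤ t * (v.2 - u.2) := by linarith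
      linarith [le_of_mul_le_mul_left this ht']
  · left
    constructor
    · have := mul_le_mul_of_nonneg_right hst (sub_nonneg.2 huw.1)
      have : s * (v.1 - u.1) ≤ s * (w.1 - u.1) := by linarith
      linarith [le_of_mul_le_mul_left this hs]
    · have := mul_le_mul_of_nonneg_right hst (sub_nonneg.2 huw.2)
      have : s * (v.2 - u.2) ≤ s * (w.2 - u.2) := by linarith
      linarith [le_of_mul_le_mul_left this hs]

/-- Two increasing segments with the same upper endpoint that meet elsewhere have comparable
lower endpoints. -/
theorem le_or_le_of_mem_segment_right {u v w p : ℝ × ℝ} (huv : v ≤ u) (huw : w ≤ u)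
    (hv : p ∈ segment ℝ v u) (hw : p ∈ segment ℝ w u) (hp : p ≠ u) : v ≤ w ∨ w ≤ v := by
  have key : ∀ {x : ℝ × ℝ}, p ∈ segment ℝ x u → -p ∈ segment ℝ (-u) (-x) := by
    rintro x ⟨a, b, ha, hb, hab, rfl⟩
    exact ⟨b, a, hb, ha, by rw [add_comm, hab], by simp [add_comm]⟩
  have := le_or_le_of_mem_segment_left (neg_le_neg huv) (neg_le_neg huw) (key hv) (key hw)
    (by simpa using hp)
  simpa [or_comm] using this

/-- A finite lattice of order dimension at most two is planar. -/
theorem isPlanarLattice_of_embedding {L : Type*} [Lattice L] [Finite L] (F : L → ℝ × ℝ)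
    (hF : ∀ x y, F x ≤ F y ↔ x ≤ y) : IsPlanarLattice L := by
  have hinj : Function.Injective F := fun x y h =>
    le_antisymm ((hF x y).1 h.le) ((hF y x).1 h.ge)
  -- This shear makes the height the sum of the coordinates, which increases strictly along the
  -- product order.
  let φ : ℝ × ℝ →ₗ[ℝ] ℝ × ℝ :=
    (LinearMap.fst ℝ ℝ ℝ).prod (LinearMap.fst ℝ ℝ ℝ + LinearMap.snd ℝ ℝ ℝ)
  have hφ : ∀ p, φ p = (p.1, p.1 + p.2) := fun p => rfl
  have hφi : Function.Injective φ := by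
    intro p q h
    simp only [hφ, Prod.mk.injEq] at h
    exact Prod.ext h.1 (by linarith [h.1, h.2])
  have hseg : ∀ a b : L, segment ℝ (φ (F a)) (φ (F b)) = φ '' segment ℝ (F a) (F b) := fun a b =>
    (image_segment ℝ φ.toAffineMap (F a) (F b)).symm
  have hmem : ∀ {a b : L} {p : ℝ × ℝ}, a ⋖ b → p ∈ segment ℝ (F a) (F b) → F a ≤ p ∧ p ≤ F b :=
    fun hab hp => segment_subset_Icc ((hF _ _).2 hab.le) hp
  have start : ∀ {a b d : L} {p}, a ⋖ b → a ⋖ d → b ≠ d → p ∈ segment ℝ (F a) (F b) →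
      p ∈ segment ℝ (F a) (F d) → p = F a := by
    intro a b d p hab had hne hp hq
    by_contra hpa
    rcases le_or_le_of_mem_segment_left ((hF _ _).2 hab.le) ((hF _ _).2 had.le) hp hq hpa with h | h
    · exact (had.eq_or_eq hab.le ((hF _ _).1 h)).elim hab.ne' hne
    · exact (hab.eq_or_eq had.le ((hF _ _).1 h)).elim had.ne' hne.symm
  have finish : ∀ {a b c : L} {p}, a ⋖ b → c ⋖ b → a ≠ c → p ∈ segment ℝ (F a) (F b) →
      p ∈ segment ℝ (F c) (F b) → p = F b := by
    intro a b c p hab hcb hne hp hq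
    by_contra hpa
    rcases le_or_le_of_mem_segment_right ((hF _ _).2 hab.le) ((hF _ _).2 hcb.le) hp hq hpa
      with h | h
    · exact (hab.eq_or_eq ((hF _ _).1 h) hcb.le).elim hne.symm hcb.ne
    · exact (hcb.eq_or_eq ((hF _ _).1 h) hab.le).elim hne hab.ne
  refine ⟨inferInstance, fun x => φ (F x), hφi.comp hinj, ?_, ?_, ?_⟩
  · intro a b hab
    have h := (hF a b).2 hab.le
    have hne : F a ≠ F b := hinj.ne hab.ne
    simp only [hφ]
    refine lt_of_le_of_ne (add_le_add h.1 h.2) fun he => hne ?_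
    exact Prod.ext (by linarith [h.1, h.2]) (by linarith [h.1, h.2])
  · intro a b c hab hc
    rw [hseg, hφi.mem_set_image] at hc
    obtain ⟨h1, h2⟩ := hmem hab hc
    exact hab.eq_or_eq ((hF _ _).1 h1) ((hF _ _).1 h2)
  · intro a b c d hab hcd hne q hq
    rw [hseg, hseg, ← Set.image_inter hφi] at hq
    obtain ⟨p, ⟨hp, hp'⟩, rfl⟩ := hq
    suffices h : (p = F a ∨ p = F b) ∧ (p = F c ∨ p = F d) by
      simpa [hφi.eq_iff] using h
    obtain ⟨h1, h2⟩ := hmem hab hp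
    obtain ⟨h3, h4⟩ := hmem hcd hp'
    have had : a ≤ d := (hF _ _).1 (h1.trans h4)
    have hcb : c ≤ b := (hF _ _).1 (h3.trans h2)
    -- A common point of the two edges gives `a ≤ d` and `c ≤ b`. Hence `a ⊔ c` lies between `a` and
    -- `b`, and the covering relation leaves only its two ends.
    rcases hab.eq_or_eq (le_sup_left : a ≤ a ⊔ c) (sup_le hab.le hcb) with h | h
    · have hca : c ≤ a := sup_eq_left.1 h
      rcases hcd.eq_or_eq hca had with rfl | rfl
      · have hbd : b ≠ d := fun h => hne (by rw [h])
        have := start hab hcd hbd hp hp'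
        simp [this]
      · have : p = F a := le_antisymm h4 h1
        simp [this]
    · have hbd : b ≤ d := by rw [← h]; exact sup_le had hcd.le
      rcases hcd.eq_or_eq hcb hbd with rfl | rfl
      · have : p = F b := le_antisymm h2 h3
        simp [this]
      · have hac : a ≠ c := fun h => hne (by rw [h])
        have := finish hab hcd hac hp hp'
        simp [this]

/-! ### Inserting elements into intervals of a lattice -/

/-- The data for inserting new elements into a lattice: the element `e` is placed between
`lo e` and `hi e`. -/
structure Insertion (G E : Type*) [Lattice G] where
  /-- The element just below the new element. -/
  lo : E → G
  /-- The element just above the new element. -/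
  hi : E → G
  lo_lt_hi : ∀ e, lo e < hi e

namespace Insertion

variable {G E : Type*} [Lattice G]

/-- The lattice with the new elements inserted. -/
def Carrier (_A : Insertion G E) : Type _ := G ⊕ E

variable {A : Insertion G E}

/-- An old element. -/
def base (a : G) : A.Carrier := Sum.inl a

/-- A new element. -/
def new (e : E) : A.Carrier := Sum.inr e

/-- The largest old element below `x`. -/
def lower (x : A.Carrier) : G := Sum.elim id A.lo x

/-- The least old element above `x`. -/
def upper (x : A.Carrier) : G := Sum.elim id A.hi x

@[simp] theorem lower_base (a : G) : lower (base a : A.Carrier) = a := rfl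
@[simp] theorem upper_base (a : G) : upper (base a : A.Carrier) = a := rfl
@[simp] theorem lower_new (e : E) : lower (new e : A.Carrier) = A.lo e := rfl
@[simp] theorem upper_new (e : E) : upper (new e : A.Carrier) = A.hi e := rfl

theorem base_or_new (x : A.Carrier) : (∃ a, x = base a) ∨ ∃ e, x = new e := by
  rcases x with a | e
  · exact Or.inl ⟨a, rfl⟩
  · exact Or.inr ⟨e, rfl⟩

theorem lower_le_upper (x : A.Carrier) : lower x ≤ upper x := by
  rcases base_or_new x with ⟨a, rfl⟩ | ⟨e, rfl⟩
  · simp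
  · exact (A.lo_lt_hi e).le

theorem eq_base_of_upper_le_lower {x : A.Carrier} (h : upper x ≤ lower x) :
    x = base (lower x) := by
  rcases base_or_new x with ⟨a, rfl⟩ | ⟨e, rfl⟩
  · simp
  · exact absurd h (A.lo_lt_hi e).not_ge

/-- Distinct elements are comparable only through old ones, so new elements with the same neighbours
are incomparable. -/
instance : PartialOrder A.Carrier where
  le x y := x = y ∨ upper x ≤ lower y
  le_refl _ := Or.inl rfl
  le_trans x y z := by
    rintro (rfl | h) (rfl | h')
    · exact Or.inl rfl
    · exact Or.inr h'
    · exact Or.inr h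
    · exact Or.inr (h.trans ((lower_le_upper y).trans h'))
  le_antisymm x y := by
    rintro (rfl | h) (h' | h')
    · rfl
    · rfl
    · exact h'.symm
    · have hx := lower_le_upper x
      have hy := lower_le_upper y
      rw [eq_base_of_upper_le_lower (h.trans (hy.trans h')),
        eq_base_of_upper_le_lower (h'.trans (hx.trans h)),
        le_antisymm (hx.trans h) (hy.trans h')]

theorem le_iff {x y : A.Carrier} : x ≤ y ↔ x = y ∨ upper x ≤ lower y := Iff.rfl

theorem base_le_iff {a : G} {x : A.Carrier} : base a ≤ x ↔ a ≤ lower x := by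
  refine ⟨?_, fun h => Or.inr h⟩
  rintro (rfl | h)
  · exact le_rfl
  · exact h

theorem le_base_iff {a : G} {x : A.Carrier} : x ≤ base a ↔ upper x ≤ a := by
  refine ⟨?_, fun h => Or.inr h⟩
  rintro (rfl | h)
  · exact le_rfl
  · exact h

theorem base_le_base {a b : G} : (base a : A.Carrier) ≤ base b ↔ a ≤ b := base_le_iff

theorem base_lower_le (x : A.Carrier) : base (lower x) ≤ x := base_le_iff.2 le_rfl

theorem le_base_upper (x : A.Carrier) : x ≤ base (upper x) := le_base_iff.2 le_rfl

theorem le_iff_of_ne {x y : A.Carrier} (h : x ≠ y) : x ≤ y ↔ upper x ≤ lower y := by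
  simp [le_iff, h]

open Classical in
noncomputable instance : Lattice A.Carrier where
  sup x y := if x ≤ y then y else if y ≤ x then x else base (upper x ⊔ upper y)
  inf x y := if x ≤ y then x else if y ≤ x then y else base (lower x ⊓ lower y)
  le_sup_left x y := by
    split_ifs with h h'
    · exact h
    · exact le_rfl
    · exact le_base_iff.2 le_sup_left
  le_sup_right x y := by
    split_ifs with h h'
    · exact le_rfl
    · exact h'
    · exact le_base_iff.2 le_sup_right
  sup_le x y z hx hy := by
    split_ifs with h h'
    · exact hy
    · exact hx
    · have hxz : x ≠ z := fun e => h' (e ▸ hy)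
      have hyz : y ≠ z := fun e => h (e ▸ hx)
      exact base_le_iff.2 (sup_le ((le_iff_of_ne hxz).1 hx) ((le_iff_of_ne hyz).1 hy))
  inf_le_left x y := by
    split_ifs with h h'
    · exact le_rfl
    · exact h'
    · exact base_le_iff.2 inf_le_left
  inf_le_right x y := by
    split_ifs with h h'
    · exact h
    · exact le_rfl
    · exact base_le_iff.2 inf_le_right
  le_inf x y z hx hy := by
    split_ifs with h h'
    · exact hx
    · exact hy
    · have hxz : x ≠ y := fun e => h (e ▸ hy)
      have hyz : x ≠ z := fun e => h' (e ▸ hx)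
      exact le_base_iff.2 (le_inf ((le_iff_of_ne hxz).1 hx) ((le_iff_of_ne hyz).1 hy))

theorem sup_of_not_le {x y : A.Carrier} (h : ¬x ≤ y) (h' : ¬y ≤ x) :
    x ⊔ y = base (upper x ⊔ upper y) :=
  (if_neg h).trans (if_neg h')

theorem inf_of_not_le {x y : A.Carrier} (h : ¬x ≤ y) (h' : ¬y ≤ x) :
    x ⊓ y = base (lower x ⊓ lower y) :=
  (if_neg h).trans (if_neg h')

theorem sup_base_of_not_le {x : A.Carrier} {g : G} (h : ¬g ≤ lower x) :
    x ⊔ base g = base (upper x ⊔ g) := by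
  by_cases h' : x ≤ base g
  · rw [sup_eq_right.2 h', sup_eq_right.2 (le_base_iff.1 h')]
  · exact sup_of_not_le h' fun h'' => h (base_le_iff.1 h'')

theorem inf_base_of_not_le {x : A.Carrier} {g : G} (h : ¬upper x ≤ g) :
    x ⊓ base g = base (lower x ⊓ g) := by
  by_cases h' : base g ≤ x
  · rw [inf_eq_right.2 h', inf_eq_right.2 (base_le_iff.1 h')]
  · exact inf_of_not_le (fun h'' => h (le_base_iff.1 h'')) h'

theorem base_sup (a b : G) : (base (a ⊔ b) : A.Carrier) = base a ⊔ base b := by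
  refine le_antisymm ?_ (sup_le (base_le_base.2 le_sup_left) (base_le_base.2 le_sup_right))
  exact base_le_iff.2
    (sup_le (base_le_iff.1 le_sup_left) (base_le_iff.1 le_sup_right))

theorem base_inf (a b : G) : (base (a ⊓ b) : A.Carrier) = base a ⊓ base b := by
  refine le_antisymm (le_inf (base_le_base.2 inf_le_left) (base_le_base.2 inf_le_right)) ?_
  exact le_base_iff.2
    (le_inf (le_base_iff.1 inf_le_left) (le_base_iff.1 inf_le_right))

/-! ### Extending congruences to the new elements -/

/-- A congruence `θ` of the old lattice extends to the new one if, for each new element `e`,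
either `lo e` and `hi e` are congruent, or `lo e` is the largest and `hi e` the least element
of its class. -/
def Extends (A : Insertion G E) (θ : LatticeCon G) : Prop :=
  ∀ e, θ.r (A.lo e) (A.hi e) ∨
    (∀ y, θ.r (A.lo e) y → y ≤ A.lo e) ∧ ∀ y, θ.r (A.hi e) y → A.hi e ≤ y

/-- The interval between the old neighbours of `x` lies in the class of `g`. -/
def Near (θ : LatticeCon G) (x : A.Carrier) (g : G) : Prop :=
  θ.r (lower x) g ∧ θ.r (upper x) g

variable {θ : LatticeCon G}

theorem Near.trans {x : A.Carrier} {g g' : G} (h : Near θ x g) (hg : θ.r g g') : Near θ x g' :=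
  ⟨θ.trans h.1 hg, θ.trans h.2 hg⟩

theorem Near.rel {x : A.Carrier} {g g' : G} (h : Near θ x g) (h' : Near θ x g') : θ.r g g' :=
  θ.trans (θ.symm h.1) h'.1

theorem Near.lower_upper {x : A.Carrier} {g : G} (h : Near θ x g) : θ.r (lower x) (upper x) :=
  θ.trans h.1 (θ.symm h.2)

theorem near_lower {x : A.Carrier} (h : θ.r (lower x) (upper x)) : Near θ x (lower x) :=
  ⟨θ.refl _, θ.symm h⟩

/-- Nothing is assumed about collapse at `z`. If `z < x`, then `upper z ≤ lower x` is absorbed;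
otherwise the join is the old element `upper x ⊔ upper z`. -/
theorem Near.sup_upper {x z : A.Carrier} {g : G} (h : Near θ x g) (hxz : ¬x ≤ z) :
    Near θ (x ⊔ z) (g ⊔ upper z) := by
  by_cases hzx : z ≤ x
  · rw [sup_eq_left.2 hzx]
    refine h.trans ?_
    have hle := (le_iff_of_ne (fun e => hxz e.ge)).1 hzx
    have := θ.sup (θ.symm h.1) (θ.refl (upper z))
    rw [sup_eq_left.2 hle] at this
    exact θ.trans (θ.symm h.1) (θ.symm this)
  · rw [sup_of_not_le hxz hzx]
    exact ⟨θ.sup h.2 (θ.refl _), θ.sup h.2 (θ.refl _)⟩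

theorem Near.inf_lower {x z : A.Carrier} {g : G} (h : Near θ x g) (hzx : ¬z ≤ x) :
    Near θ (x ⊓ z) (g ⊓ lower z) := by
  by_cases hxz : x ≤ z
  · rw [inf_eq_left.2 hxz]
    refine h.trans ?_
    have hle := (le_iff_of_ne (fun e => hzx e.ge)).1 hxz
    have := θ.inf (θ.symm h.2) (θ.refl (lower z))
    rw [inf_eq_left.2 hle] at this
    exact θ.trans (θ.symm h.2) (θ.symm this)
  · rw [inf_of_not_le hxz hzx]
    exact ⟨θ.inf h.1 (θ.refl _), θ.inf h.1 (θ.refl _)⟩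

theorem Near.sup {x z : A.Carrier} {g h : G} (hx : Near θ x g) (hz : Near θ z h) :
    Near θ (x ⊔ z) (g ⊔ h) := by
  by_cases hxz : x ≤ z
  · by_cases hzx : z ≤ x
    · obtain rfl := le_antisymm hxz hzx
      rw [sup_idem]
      refine hx.trans ?_
      have := θ.sup (θ.refl g) (hx.rel hz)
      rwa [sup_idem] at this
    · rw [sup_comm, sup_comm g]
      exact (hz.sup_upper hzx).trans (θ.sup (θ.refl _) hx.2)
  · exact (hx.sup_upper hxz).trans (θ.sup (θ.refl _) hz.2)

theorem Near.inf {x z : A.Carrier} {g h : G} (hx : Near θ x g) (hz : Near θ z h) :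
    Near θ (x ⊓ z) (g ⊓ h) := by
  by_cases hzx : z ≤ x
  · by_cases hxz : x ≤ z
    · obtain rfl := le_antisymm hxz hzx
      rw [inf_idem]
      refine hx.trans ?_
      have := θ.inf (θ.refl g) (hx.rel hz)
      rwa [inf_idem] at this
    · rw [inf_comm, inf_comm g]
      exact (hz.inf_lower hxz).trans (θ.inf (θ.refl _) hx.1)
  · exact (hx.inf_lower hzx).trans (θ.inf (θ.refl _) hz.1)

/-- The relation on the new lattice extending `θ`. -/
def ExtRel (θ : LatticeCon G) (x y : A.Carrier) : Prop := x = y ∨ ∃ g, Near θ x g ∧ Near θ y g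

theorem ExtRel.symm {x y : A.Carrier} (h : ExtRel θ x y) : ExtRel θ y x :=
  h.imp Eq.symm fun ⟨g, hx, hy⟩ => ⟨g, hy, hx⟩

theorem ExtRel.trans {x y z : A.Carrier} (h : ExtRel θ x y) (h' : ExtRel θ y z) :
    ExtRel θ x z := by
  rcases h with rfl | ⟨g, hx, hy⟩
  · exact h'
  rcases h' with rfl | ⟨g', hy', hz⟩
  · exact Or.inr ⟨g, hx, hy⟩
  · exact Or.inr ⟨g, hx, hz.trans (hy'.rel hy)⟩

theorem Extends.lower_max (hA : A.Extends θ) {z : A.Carrier} (hz : ¬θ.r (lower z) (upper z))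
    {y : G} (h : θ.r (lower z) y) : y ≤ lower z := by
  rcases base_or_new z with ⟨a, rfl⟩ | ⟨e, rfl⟩
  · exact absurd (θ.refl _) hz
  · exact ((hA e).resolve_left hz).1 y h

theorem Extends.upper_min (hA : A.Extends θ) {z : A.Carrier} (hz : ¬θ.r (lower z) (upper z))
    {y : G} (h : θ.r (upper z) y) : upper z ≤ y := by
  rcases base_or_new z with ⟨a, rfl⟩ | ⟨e, rfl⟩
  · exact absurd (θ.refl _) hz
  · exact ((hA e).resolve_left hz).2 y h

/-- `lower z ⊔ upper y` is congruent to `lower z`, hence below it by maximality. So a class with one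
member below an uncollapsed `z` lies entirely below `z`, and joins with `z` cannot separate it. -/
theorem Near.le_of_le (hA : A.Extends θ) {x y z : A.Carrier} {g : G}
    (hz : ¬θ.r (lower z) (upper z)) (hx : Near θ x g) (hy : Near θ y g) (h : x ≤ z) : y ≤ z := by
  rcases h with rfl | h
  · exact absurd hx.lower_upper hz
  refine Or.inr (sup_eq_right.1 (le_antisymm (hA.lower_max hz ?_) le_sup_right))
  have := θ.sup (θ.trans hx.2 (θ.symm hy.2)) (θ.refl (lower z))
  rwa [sup_eq_right.2 h] at this

theorem Near.ge_of_ge (hA : A.Extends θ) {x y z : A.Carrier} {g : G}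
    (hz : ¬θ.r (lower z) (upper z)) (hx : Near θ x g) (hy : Near θ y g) (h : z ≤ x) : z ≤ y := by
  rcases h with rfl | h
  · exact absurd hx.lower_upper hz
  refine Or.inr (inf_eq_left.1 (le_antisymm inf_le_left (hA.upper_min hz ?_)))
  have := θ.inf (θ.refl (upper z)) (θ.trans hx.1 (θ.symm hy.1))
  rwa [inf_eq_left.2 h] at this

theorem ExtRel.sup_right (hA : A.Extends θ) {x y : A.Carrier} (h : ExtRel θ x y) (z : A.Carrier) :
    ExtRel θ (x ⊔ z) (y ⊔ z) := by
  rcases h with rfl | ⟨g, hx, hy⟩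
  · exact Or.inl rfl
  by_cases hz : θ.r (lower z) (upper z)
  · exact Or.inr ⟨_, hx.sup (near_lower hz), hy.sup (near_lower hz)⟩
  by_cases hxz : x ≤ z
  · have hyz := Near.le_of_le hA hz hx hy hxz
    exact Or.inl (by rw [sup_eq_right.2 hxz, sup_eq_right.2 hyz])
  · have hyz : ¬y ≤ z := fun h => hxz (Near.le_of_le hA hz hy hx h)
    exact Or.inr ⟨_, hx.sup_upper hxz, hy.sup_upper hyz⟩

theorem ExtRel.inf_right (hA : A.Extends θ) {x y : A.Carrier} (h : ExtRel θ x y) (z : A.Carrier) :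
    ExtRel θ (x ⊓ z) (y ⊓ z) := by
  rcases h with rfl | ⟨g, hx, hy⟩
  · exact Or.inl rfl
  by_cases hz : θ.r (lower z) (upper z)
  · exact Or.inr ⟨_, hx.inf (near_lower hz), hy.inf (near_lower hz)⟩
  by_cases hxz : z ≤ x
  · have hyz := Near.ge_of_ge hA hz hx hy hxz
    exact Or.inl (by rw [inf_eq_right.2 hxz, inf_eq_right.2 hyz])
  · have hyz : ¬z ≤ y := fun h => hxz (Near.ge_of_ge hA hz hy hx h)
    exact Or.inr ⟨_, hx.inf_lower hxz, hy.inf_lower hyz⟩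

/-- The congruence of the new lattice extending `θ`. -/
def extend (θ : LatticeCon G) (hA : A.Extends θ) : LatticeCon A.Carrier where
  r := ExtRel θ
  iseqv := ⟨fun _ => Or.inl rfl, ExtRel.symm, ExtRel.trans⟩
  inf {w x y z} h h' := by
    refine (h.inf_right hA y).trans ?_
    rw [inf_comm x, inf_comm x]
    exact ExtRel.inf_right hA h' x
  sup {w x y z} h h' := by
    refine (h.sup_right hA y).trans ?_
    rw [sup_comm x, sup_comm x]
    exact ExtRel.sup_right hA h' x

theorem extRel_base {a b : G} : ExtRel θ (base a : A.Carrier) (base b) ↔ θ.r a b := by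
  constructor
  · rintro (h | ⟨g, h, h'⟩)
    · obtain rfl : a = b := Sum.inl_injective h
      exact θ.refl _
    · exact θ.trans h.1 (θ.symm h'.1)
  · exact fun h => Or.inr ⟨b, ⟨h, h⟩, ⟨θ.refl _, θ.refl _⟩⟩

/-- The restriction of a congruence to the old elements. -/
def restrict (c : LatticeCon A.Carrier) : LatticeCon G where
  r a b := c.r (base a) (base b)
  iseqv := ⟨fun _ => c.refl _, fun h => c.symm h, fun h h' => c.trans h h'⟩
  inf h h' := by simpa only [base_inf] using c.inf h h'
  sup h h' := by simpa only [base_sup] using c.sup h h'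

end Insertion

/-! ### Congruences determined by their restriction -/

theorem LatticeCon.rel_left_of_le {L : Type*} [Lattice L] (c : LatticeCon L) {x y z : L}
    (hxy : x ≤ y) (hyz : y ≤ z) (h : c.r x z) : c.r x y := by
  simpa [inf_eq_right.2 hxy, inf_eq_left.2 hyz] using c.inf (c.refl y) h

theorem LatticeCon.rel_right_of_le {L : Type*} [Lattice L] (c : LatticeCon L) {x y z : L}
    (hxy : x ≤ y) (hyz : y ≤ z) (h : c.r x z) : c.r y z :=
  c.trans (c.symm (c.rel_left_of_le hxy hyz h)) h

namespace Insertion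

variable {G E : Type*} [Lattice G] {A : Insertion G E}

/-- A congruence identifying `x` with its lower neighbour identifies the joins of both neighbours
with any old element that is not below `x`. -/
theorem rel_sup_of_rel_lower {c : LatticeCon A.Carrier} {x : A.Carrier}
    (h : c.r (base (lower x)) x) {g : G} (hg : ¬g ≤ lower x) :
    (restrict c).r (lower x ⊔ g) (upper x ⊔ g) := by
  have := c.sup h (c.refl (base g))
  rwa [← base_sup, sup_base_of_not_le hg] at this

/-- A congruence identifying `x` with its upper neighbour identifies the meets of both neighbours
with any old element that is not above `x`. -/
theorem rel_inf_of_rel_upper {c : LatticeCon A.Carrier} {x : A.Carrier}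
    (h : c.r x (base (upper x))) {g : G} (hg : ¬upper x ≤ g) :
    (restrict c).r (lower x ⊓ g) (upper x ⊓ g) := by
  have := c.inf h (c.refl (base g))
  rwa [← base_inf, inf_base_of_not_le hg] at this

/-- A congruence that collapses `lo e` and `hi e` whenever it identifies `e` with one of them is
determined by its restriction to the old elements. -/
theorem rel_iff_extRel_restrict (c : LatticeCon A.Carrier)
    (hc : ∀ e, c.r (base (A.lo e)) (new e) ∨ c.r (new e) (base (A.hi e)) →
      c.r (base (A.lo e)) (base (A.hi e))) (x y : A.Carrier) :
    c.r x y ↔ ExtRel (restrict c) x y := by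
  have collapse : ∀ {x y : A.Carrier}, c.r x y → x ≠ y →
      c.r (base (lower x)) (base (upper x)) := by
    intro x y h hne
    rcases base_or_new x with ⟨a, rfl⟩ | ⟨e, rfl⟩
    · exact c.refl _
    apply hc
    -- Joining or meeting with `new e` replaces `y` by an element strictly above or below it; by
    -- convexity an old neighbour of `e` is then identified with `e`.
    by_cases hle : new e ≤ y
    · right
      have hlt : new e < new e ⊔ y := lt_of_le_of_ne le_sup_left fun he =>
        hne (le_antisymm hle (by rw [he]; exact le_sup_right))
      have hs := c.sup (c.refl (new e)) h
      rw [sup_idem] at hs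
      exact c.rel_left_of_le (le_base_upper _)
        (base_le_iff.2 ((le_iff_of_ne hlt.ne).1 hlt.le)) hs
    · left
      have hlt : new e ⊓ y < new e := lt_of_le_of_ne inf_le_left fun he => hle (inf_eq_left.1 he)
      have hs := c.inf (c.refl (new e)) h
      rw [inf_idem] at hs
      exact c.rel_right_of_le (le_base_iff.2 ((le_iff_of_ne hlt.ne).1 hlt.le))
        (base_lower_le (new e)) (c.symm hs)
  have to_lower : ∀ {x : A.Carrier}, c.r (base (lower x)) (base (upper x)) →
      c.r (base (lower x)) x := fun {x} h =>
    c.rel_left_of_le (base_lower_le x) (le_base_upper x) h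
  constructor
  · intro h
    by_cases hne : x = y
    · exact Or.inl hne
    have hx := collapse h hne
    have hy := collapse (c.symm h) (Ne.symm hne)
    have hxy : c.r (base (lower y)) (base (lower x)) :=
      c.trans (to_lower hy) (c.trans (c.symm h) (c.symm (to_lower hx)))
    exact Or.inr ⟨lower x, ⟨c.refl _, c.symm hx⟩, ⟨hxy, c.trans (c.symm hy) hxy⟩⟩
  · rintro (rfl | ⟨g, hx, hy⟩)
    · exact c.refl _
    · have hx' := to_lower hx.lower_upper
      have hy' := to_lower hy.lower_upper
      exact c.trans (c.symm hx') (c.trans hx.1 (c.trans (c.symm hy.1) hy'))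

end Insertion

/-! ### Congruences of grids -/

/-- The product of a chain of length `a` and a chain of length `b`. -/
abbrev Grid (a b : ℕ) : Type := Fin (a + 1) × Fin (b + 1)

namespace Grid

variable {a b : ℕ}

/-- The grid point with the given coordinates, which are cut off at `a` and `b`. -/
def pt (i j : ℕ) : Grid a b :=
  (⟨min i a, by omega⟩, ⟨min j b, by omega⟩)

@[simp] theorem pt_fst (i j : ℕ) : ((pt i j : Grid a b).1 : ℕ) = min i a := rfl
@[simp] theorem pt_snd (i j : ℕ) : ((pt i j : Grid a b).2 : ℕ) = min j b := rfl

@[simp] theorem fst_sup (x y : Grid a b) : ((x ⊔ y).1 : ℕ) = max (x.1 : ℕ) y.1 := rfl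
@[simp] theorem snd_sup (x y : Grid a b) : ((x ⊔ y).2 : ℕ) = max (x.2 : ℕ) y.2 := rfl
@[simp] theorem fst_inf (x y : Grid a b) : ((x ⊓ y).1 : ℕ) = min (x.1 : ℕ) y.1 := rfl
@[simp] theorem snd_inf (x y : Grid a b) : ((x ⊓ y).2 : ℕ) = min (x.2 : ℕ) y.2 := rfl

theorem ext_val {x y : Grid a b} (h₁ : (x.1 : ℕ) = y.1) (h₂ : (x.2 : ℕ) = y.2) : x = y :=
  Prod.ext (Fin.ext h₁) (Fin.ext h₂)

theorem le_iff {x y : Grid a b} : x ≤ y ↔ (x.1 : ℕ) ≤ y.1 ∧ (x.2 : ℕ) ≤ y.2 := Iff.rfl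

theorem pt_val (x : Grid a b) : pt (x.1 : ℕ) (x.2 : ℕ) = x :=
  ext_val (by simp; omega) (by simp; omega)

theorem pt_sup (i j i' j' : ℕ) : (pt i j ⊔ pt i' j' : Grid a b) = pt (max i i') (max j j') :=
  ext_val (by simp; omega) (by simp; omega)

theorem pt_inf (i j i' j' : ℕ) : (pt i j ⊓ pt i' j' : Grid a b) = pt (min i i') (min j j') :=
  ext_val (by simp) (by simp)

theorem pt_mono {i j i' j' : ℕ} (hi : i ≤ i') (hj : j ≤ j') : (pt i j : Grid a b) ≤ pt i' j' :=
  le_iff.2 ⟨by simp; omega, by simp; omega⟩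

/-- The congruence of the grid that collapses the horizontal edges in `H` and the vertical edges
in `V`. -/
def con (H V : ℕ → Prop) : LatticeCon (Grid a b) where
  r x y := (∀ k, min (x.1 : ℕ) y.1 ≤ k → k < max (x.1 : ℕ) y.1 → H k) ∧
    ∀ k, min (x.2 : ℕ) y.2 ≤ k → k < max (x.2 : ℕ) y.2 → V k
  iseqv := by
    refine ⟨fun x => ⟨fun k _ _ => ?_, fun k _ _ => ?_⟩, fun h => ?_,
      fun {x y z} h h' => ⟨fun k h₁ h₂ => ?_, fun k h₁ h₂ => ?_⟩⟩
    · omega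
    · omega
    · simpa only [min_comm, max_comm] using h
    · rcases (by omega : (min (x.1 : ℕ) y.1 ≤ k ∧ k < max (x.1 : ℕ) y.1) ∨
        (min (y.1 : ℕ) z.1 ≤ k ∧ k < max (y.1 : ℕ) z.1)) with g | g
      · exact h.1 k g.1 g.2
      · exact h'.1 k g.1 g.2
    · rcases (by omega : (min (x.2 : ℕ) y.2 ≤ k ∧ k < max (x.2 : ℕ) y.2) ∨
        (min (y.2 : ℕ) z.2 ≤ k ∧ k < max (y.2 : ℕ) z.2)) with g | g
      · exact h.2 k g.1 g.2
      · exact h'.2 k g.1 g.2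
  inf {w x y z} h h' := by
    simp only [fst_inf, snd_inf]
    refine ⟨fun k h₁ h₂ => ?_, fun k h₁ h₂ => ?_⟩
    -- The interval spanned by the two meets is covered by the intervals spanned by the given pairs.
    · rcases (by omega : (min (w.1 : ℕ) x.1 ≤ k ∧ k < max (w.1 : ℕ) x.1) ∨
        (min (y.1 : ℕ) z.1 ≤ k ∧ k < max (y.1 : ℕ) z.1)) with g | g
      · exact h.1 k g.1 g.2
      · exact h'.1 k g.1 g.2
    · rcases (by omega : (min (w.2 : ℕ) x.2 ≤ k ∧ k < max (w.2 : ℕ) x.2) ∨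
        (min (y.2 : ℕ) z.2 ≤ k ∧ k < max (y.2 : ℕ) z.2)) with g | g
      · exact h.2 k g.1 g.2
      · exact h'.2 k g.1 g.2
  sup {w x y z} h h' := by
    simp only [fst_sup, snd_sup]
    refine ⟨fun k h₁ h₂ => ?_, fun k h₁ h₂ => ?_⟩
    · rcases (by omega : (min (w.1 : ℕ) x.1 ≤ k ∧ k < max (w.1 : ℕ) x.1) ∨
        (min (y.1 : ℕ) z.1 ≤ k ∧ k < max (y.1 : ℕ) z.1)) with g | g
      · exact h.1 k g.1 g.2
      · exact h'.1 k g.1 g.2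
    · rcases (by omega : (min (w.2 : ℕ) x.2 ≤ k ∧ k < max (w.2 : ℕ) x.2) ∨
        (min (y.2 : ℕ) z.2 ≤ k ∧ k < max (y.2 : ℕ) z.2)) with g | g
      · exact h.2 k g.1 g.2
      · exact h'.2 k g.1 g.2

theorem con_r {H V : ℕ → Prop} {x y : Grid a b} :
    (con H V).r x y ↔ (∀ k, min (x.1 : ℕ) y.1 ≤ k → k < max (x.1 : ℕ) y.1 → H k) ∧
      ∀ k, min (x.2 : ℕ) y.2 ≤ k → k < max (x.2 : ℕ) y.2 → V k := Iff.rfl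

variable (c : LatticeCon (Grid a b))

/-- Meets with `pt i' 0` and `pt 0 j'` project the pair onto the axes, where convexity yields the
single edges; joining the projections recovers the pair. -/
theorem rel_pt_of_le {i j i' j' : ℕ} (hi : i ≤ i') (hj : j ≤ j') :
    c.r (pt i j) (pt i' j') ↔ (∀ k, i ≤ k → k < i' → c.r (pt k 0) (pt (k + 1) 0)) ∧
      ∀ k, j ≤ k → k < j' → c.r (pt 0 k) (pt 0 (k + 1)) := by
  constructor
  · intro h
    have h₁ := c.inf h (c.refl (pt i' 0))
    have h₂ := c.inf h (c.refl (pt 0 j'))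
    simp only [pt_inf, min_eq_left hi, min_eq_left hj, min_self, Nat.min_zero] at h₁ h₂
    constructor
    · intro k hk hk'
      exact c.rel_right_of_le (pt_mono hk le_rfl) (pt_mono k.le_succ le_rfl)
        (c.rel_left_of_le (pt_mono (hk.trans k.le_succ) le_rfl) (pt_mono hk' le_rfl) h₁)
    · intro k hk hk'
      exact c.rel_right_of_le (pt_mono le_rfl hk) (pt_mono le_rfl k.le_succ)
        (c.rel_left_of_le (pt_mono le_rfl (hk.trans k.le_succ)) (pt_mono le_rfl hk') h₂)
  · rintro ⟨hH, hV⟩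
    have h₁ : c.r (pt i 0) (pt i' 0) := by
      induction i', hi using Nat.le_induction with
      | base => exact c.refl _
      | succ m hm ih =>
        exact c.trans (ih fun k hk hk' => hH k hk (hk'.trans m.lt_succ_self))
          (hH m hm m.lt_succ_self)
    have h₂ : c.r (pt 0 j) (pt 0 j') := by
      induction j', hj using Nat.le_induction with
      | base => exact c.refl _
      | succ m hm ih =>
        exact c.trans (ih fun k hk hk' => hV k hk (hk'.trans m.lt_succ_self))
          (hV m hm m.lt_succ_self)
    simpa [pt_sup] using c.sup h₁ h₂

/-- A congruence of a grid is determined by the edges it collapses. -/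
theorem rel_iff (x y : Grid a b) :
    c.r x y ↔ (con (a := a) (b := b) (fun k => c.r (pt k 0) (pt (k + 1) 0))
      fun k => c.r (pt 0 k) (pt 0 (k + 1))).r x y := by
  rw [con_r, ← rel_pt_of_le c min_le_max min_le_max, ← pt_inf, ← pt_sup, pt_val, pt_val,
    c.r_inf_sup_iff]

theorem rel_horizontal_iff (k j : ℕ) :
    c.r (pt k j) (pt (k + 1) j) ↔ c.r (pt k 0) (pt (k + 1) 0) := by
  rw [rel_pt_of_le c k.le_succ le_rfl]
  refine ⟨fun h => h.1 k le_rfl k.lt_succ_self, fun h => ⟨fun m h₁ h₂ => ?_, fun m h₁ h₂ => ?_⟩⟩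
  · obtain rfl : k = m := by omega
    exact h
  · omega

theorem rel_vertical_iff (i k : ℕ) :
    c.r (pt i k) (pt i (k + 1)) ↔ c.r (pt 0 k) (pt 0 (k + 1)) := by
  rw [rel_pt_of_le c le_rfl k.le_succ]
  refine ⟨fun h => h.2 k le_rfl k.lt_succ_self, fun h => ⟨fun m h₁ h₂ => ?_, fun m h₁ h₂ => ?_⟩⟩
  · omega
  · obtain rfl : k = m := by omega
    exact h

end Grid

/-! ### The coloured grid with its new elements -/

/-- The positions of the new elements. The new element at `(X, j)` lies in row `j`; if `X` is odd,
it lies inside the cell of column `X / 2`, and if `X` is even, on the vertical line `X / 2`. -/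
def NewElt (n : ℕ) (R : ℕ → ℕ → Prop) : Type :=
  -- `X / 4` is the colour of column `X / 2`. For `X = 4 * i + 2` the line is `2 * i + 1`, with a
  -- column of colour `i` on either side.
  {p : Fin (4 * n) × Fin n // ((p.1 : ℕ) % 2 = 1 ∧ (p.2 : ℕ) = p.1 / 4) ∨
    ((p.1 : ℕ) % 4 = 2 ∧ R p.2 (p.1 / 4))}

namespace NewElt

variable {n : ℕ} {R : ℕ → ℕ → Prop}

/-- The horizontal position. -/
def col (e : NewElt n R) : ℕ := e.1.1

/-- The row. -/
def row (e : NewElt n R) : ℕ := e.1.2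

theorem col_lt (e : NewElt n R) : e.col < 4 * n := e.1.1.2
theorem row_lt (e : NewElt n R) : e.row < n := e.1.2.2

theorem spec (e : NewElt n R) :
    (e.col % 2 = 1 ∧ e.row = e.col / 4) ∨ (e.col % 4 = 2 ∧ R e.row (e.col / 4)) := e.2

theorem ext {e e' : NewElt n R} (h₁ : e.col = e'.col) (h₂ : e.row = e'.row) : e = e' :=
  Subtype.ext (Prod.ext (Fin.ext h₁) (Fin.ext h₂))

/-- The new element inside the cell of column `k` and row `k / 2`. -/
def cell (R : ℕ → ℕ → Prop) {k : ℕ} (hk : k < 2 * n) : NewElt n R :=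
  ⟨(⟨2 * k + 1, by omega⟩, ⟨k / 2, by omega⟩), Or.inl ⟨by simp, by simp; omega⟩⟩

/-- The new element on the vertical line `2 * i + 1` in row `j`. -/
def line {i j : ℕ} (hi : i < n) (hj : j < n) (h : R j i) : NewElt n R :=
  ⟨(⟨4 * i + 2, by omega⟩, ⟨j, hj⟩), Or.inr ⟨by simp, by
    have : (4 * i + 2) / 4 = i := by omega
    simpa [this] using h⟩⟩

@[simp] theorem col_cell {k : ℕ} (hk : k < 2 * n) : (cell R hk).col = 2 * k + 1 := rfl
@[simp] theorem row_cell {k : ℕ} (hk : k < 2 * n) : (cell R hk).row = k / 2 := rfl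
@[simp] theorem col_line {i j : ℕ} (hi : i < n) (hj : j < n) (h : R j i) :
    (line hi hj h).col = 4 * i + 2 := rfl
@[simp] theorem row_line {i j : ℕ} (hi : i < n) (hj : j < n) (h : R j i) :
    (line hi hj h).row = j := rfl

end NewElt

open Insertion Grid

/-- The insertion of the new elements into the grid. -/
def gridInsertion (n : ℕ) (R : ℕ → ℕ → Prop) : Insertion (Grid (2 * n) n) (NewElt n R) where
  lo e := pt (e.col / 2) e.row
  hi e := pt ((e.col + 1) / 2) (e.row + 1)
  lo_lt_hi e := by
    refine lt_of_le_of_ne (pt_mono (by omega) (by omega)) fun h => ?_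
    have := congrArg (fun x : Grid (2 * n) n => (x.2 : ℕ)) h
    have := e.row_lt
    simp only [pt_snd] at *
    omega

/-- The lattice obtained from the grid by inserting the new elements. -/
abbrev GridLattice (n : ℕ) (R : ℕ → ℕ → Prop) : Type := (gridInsertion n R).Carrier

namespace GridLattice

variable {n : ℕ} {R : ℕ → ℕ → Prop}

instance : Finite (GridLattice n R) :=
  inferInstanceAs (Finite (Grid (2 * n) n ⊕ {_p : Fin (4 * n) × Fin n // _}))

instance : Nonempty (GridLattice n R) := ⟨base (pt 0 0)⟩

theorem card_le (hn : 0 < n) : Nat.card (GridLattice n R) ≤ 10 * n ^ 2 := by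
  have h₁ : Nat.card (GridLattice n R) = Nat.card (Grid (2 * n) n) + Nat.card (NewElt n R) :=
    @Nat.card_sum _ _ _ (inferInstanceAs (Finite {_p : Fin (4 * n) × Fin n // _}))
  have h₂ : Nat.card (NewElt n R) ≤ 4 * n * n := by
    refine (Finite.card_subtype_le _).trans ?_
    simp
  have h₃ : Nat.card (Grid (2 * n) n) = (2 * n + 1) * (n + 1) := by simp
  rw [h₁, h₃]
  -- The bound is `6n² + 3n + 1`, at most `10n²` for `n ≥ 1`.
  nlinarith

@[simp] theorem lo_eq (e : NewElt n R) : (gridInsertion n R).lo e = pt (e.col / 2) e.row := rfl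
@[simp] theorem hi_eq (e : NewElt n R) :
    (gridInsertion n R).hi e = pt ((e.col + 1) / 2) (e.row + 1) := rfl

/-! ### The plane embedding -/

/-- The coordinates of an embedding of the lattice into the plane. -/
def position (x : GridLattice n R) : ℕ × ℕ :=
  Sum.elim (fun a : Grid (2 * n) n => (2 * (a.1 : ℕ), (4 * n + 2) * (a.2 : ℕ) + 0))
    (fun e : NewElt n R => (e.col, (4 * n + 2) * e.row + (4 * n + 1 - e.col))) x

theorem position_base (a : Grid (2 * n) n) : position (base a : GridLattice n R) =
    (2 * (a.1 : ℕ), (4 * n + 2) * (a.2 : ℕ) + 0) := rfl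

theorem position_new (e : NewElt n R) : position (new e : GridLattice n R) =
    (e.col, (4 * n + 2) * e.row + (4 * n + 1 - e.col)) := rfl

theorem mul_add_le_mul_add_iff {m r r' u v : ℕ} (hu : u < m) (hv : v < m) :
    m * r + u ≤ m * r' + v ↔ r < r' ∨ r = r' ∧ u ≤ v := by
  rcases lt_trichotomy r r' with h | rfl | h
  · have := Nat.mul_le_mul_left m (Nat.succ_le_of_lt h)
    rw [Nat.mul_succ] at this
    omega
  · omega
  · have := Nat.mul_le_mul_left m (Nat.succ_le_of_lt h)
    rw [Nat.mul_succ] at this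
    omega

/-- The second coordinate is dominated by the row. Within a row the offset of a new element is
positive and decreases with its column, so new elements of one row form an antichain. -/
theorem position_le_iff (x y : GridLattice n R) : position x ≤ position y ↔ x ≤ y := by
  rcases base_or_new x with ⟨a, rfl⟩ | ⟨e, rfl⟩ <;> rcases base_or_new y with ⟨b, rfl⟩ | ⟨e', rfl⟩
  · rw [position_base, position_base, Prod.mk_le_mk,
      mul_add_le_mul_add_iff (by omega) (by omega), base_le_base, Grid.le_iff]
    omega
  · have := e'.col_lt
    have := e'.row_lt
    rw [position_base, position_new, Prod.mk_le_mk,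
      mul_add_le_mul_add_iff (by omega) (by omega), base_le_iff, Grid.le_iff]
    simp only [lower_new, lo_eq, pt_fst, pt_snd]
    omega
  · have := e.col_lt
    have := e.row_lt
    rw [position_base, position_new, Prod.mk_le_mk,
      mul_add_le_mul_add_iff (by omega) (by omega), le_base_iff, Grid.le_iff]
    simp only [upper_new, hi_eq, pt_fst, pt_snd]
    omega
  · have := e.col_lt
    have := e.row_lt
    have := e'.col_lt
    have := e'.row_lt
    have hs := e.spec
    have hs' := e'.spec
    rw [position_new, position_new, Prod.mk_le_mk,
      mul_add_le_mul_add_iff (by omega) (by omega), Insertion.le_iff, Grid.le_iff]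
    simp only [lower_new, upper_new, lo_eq, hi_eq, pt_fst, pt_snd]
    constructor
    · rintro ⟨h₁, h₂ | h₂⟩
      -- With `e` in a lower row, this could fail only if both elements were in cells of the same
      -- column; but each column has just one such cell.
      · right
        omega
      · left
        rw [NewElt.ext (by omega) h₂.1 (e := e) (e' := e')]
    · rintro (h | h)
      · obtain rfl : e = e' := Sum.inr_injective h
        omega
      · omega

theorem isPlanarLattice : IsPlanarLattice (GridLattice n R) := by
  refine isPlanarLattice_of_embedding
    (fun x => (((position x).1 : ℝ), ((position x).2 : ℝ))) fun x y => ?_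
  rw [← position_le_iff, Prod.mk_le_mk, Nat.cast_le, Nat.cast_le, Prod.le_def]

/-! ### From closed sets of colours to congruences -/

/-- The sets of colours that are closed under `R`. -/
abbrev ClosedSet (n : ℕ) (R : ℕ → ℕ → Prop) : Type :=
  {S : Set (Fin n) // ∀ i j : Fin n, R j i → i ∈ S → j ∈ S}

/-- Membership of a natural number in a set of colours; numbers that are no colours count as
members. -/
def Mem (S : ClosedSet n R) (j : ℕ) : Prop := ∀ h : j < n, (⟨j, h⟩ : Fin n) ∈ S.1

theorem Mem.of_rel {S : ClosedSet n R} {i j : ℕ} (hi : i < n) (h : R j i) (hS : Mem S i) :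
    Mem S j := fun hj => S.2 ⟨i, hi⟩ ⟨j, hj⟩ h (hS hi)

/-- The congruence of the grid that collapses the edges with colours in `S`. -/
def gridCon (S : ClosedSet n R) : LatticeCon (Grid (2 * n) n) :=
  Grid.con (fun k => Mem S (k / 2)) (Mem S)

theorem gridCon_r {S : ClosedSet n R} {x y : Grid (2 * n) n} : (gridCon S).r x y ↔
    (∀ k, min (x.1 : ℕ) y.1 ≤ k → k < max (x.1 : ℕ) y.1 → Mem S (k / 2)) ∧
      ∀ k, min (x.2 : ℕ) y.2 ≤ k → k < max (x.2 : ℕ) y.2 → Mem S k := Iff.rfl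

/-- The columns next to a new element all have colour `e.col / 4`. If the colour of its row is not
in `S`, neither is that colour: they agree for a cell, and closure under `R` applies on a line. So
no collapsed edge leads up or right from `lo e`, or down or left from `hi e`. -/
theorem extends_gridCon (S : ClosedSet n R) : (gridInsertion n R).Extends (gridCon S) := by
  intro e
  have hc := e.col_lt
  have hr := e.row_lt
  have hs := e.spec
  simp only [lo_eq, hi_eq, gridCon_r, pt_fst, pt_snd, Grid.le_iff]
  by_cases h : Mem S e.row
  · left
    constructor
    · intro k h₁ h₂
      have : k / 2 = e.row := by omega
      rwa [this]
    · intro k h₁ h₂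
      obtain rfl : k = e.row := by omega
      exact h
  · right
    have hcol : ¬Mem S (e.col / 4) := by
      rcases hs with hs | hs
      · rwa [← hs.2]
      · exact fun h' => h (h'.of_rel (by omega) hs.2)
    refine ⟨fun y hy => ⟨?_, ?_⟩, fun y hy => ⟨?_, ?_⟩⟩
    · by_contra hlt
      have := hy.1 (e.col / 2) (by omega) (by omega)
      rw [(by omega : e.col / 2 / 2 = e.col / 4)] at this
      exact hcol this
    · by_contra hlt
      exact h (hy.2 e.row (by omega) (by omega))
    · by_contra hlt
      have := hy.1 ((e.col + 1) / 2 - 1) (by omega) (by omega)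
      rw [(by omega : ((e.col + 1) / 2 - 1) / 2 = e.col / 4)] at this
      exact hcol this
    · by_contra hlt
      exact h (hy.2 e.row (by omega) (by omega))

/-- The congruence of the lattice that collapses the edges with colours in `S`. -/
def toCon (S : ClosedSet n R) : LatticeCon (GridLattice n R) :=
  extend (gridCon S) (extends_gridCon S)

theorem toCon_base {S : ClosedSet n R} {x y : Grid (2 * n) n} :
    (toCon S).r (base x) (base y) ↔ (gridCon S).r x y := extRel_base

theorem gridCon_edge {S : ClosedSet n R} (j : Fin n) :
    (gridCon S).r (pt 0 j) (pt 0 (j + 1)) ↔ j ∈ S.1 := by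
  have hj := j.2
  simp only [gridCon_r, pt_fst, pt_snd]
  constructor
  · exact fun h => h.2 j (by omega) (by omega) hj
  · refine fun h => ⟨by omega, fun k h₁ h₂ _ => ?_⟩
    obtain rfl : k = j := by omega
    exact h

theorem toCon_le_iff (S T : ClosedSet n R) : toCon S ≤ toCon T ↔ S ≤ T := by
  constructor
  · intro h j hj
    exact (gridCon_edge j).1 (toCon_base.1 (h (toCon_base.2 ((gridCon_edge j).2 hj))))
  · intro h x y hxy
    have hg : ∀ {a b}, (gridCon S).r a b → (gridCon T).r a b := fun hab =>
      ⟨fun k h₁ h₂ hk => h (hab.1 k h₁ h₂ hk), fun k h₁ h₂ hk => h (hab.2 k h₁ h₂ hk)⟩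
    exact hxy.imp id fun ⟨g, hx, hy⟩ => ⟨g, ⟨hg hx.1, hg hx.2⟩, ⟨hg hy.1, hg hy.2⟩⟩

/-! ### Every congruence comes from a closed set -/

variable (c : LatticeCon (GridLattice n R))

/-- In a cell, joins or meets with the two other corners yield a vertical and a horizontal edge,
which compose to the diagonal. On a line, the neighbouring line to the right (for joins) or left
(for meets) receives the whole vertical edge; both exist because the line has odd index. -/
theorem restrict_lo_hi (e : NewElt n R)
    (h : c.r (base ((gridInsertion n R).lo e)) (new e) ∨
      c.r (new e) (base ((gridInsertion n R).hi e))) :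
    (restrict c).r (pt (e.col / 2) e.row) (pt ((e.col + 1) / 2) (e.row + 1)) := by
  have hc := e.col_lt
  have hr := e.row_lt
  have hsup : c.r (base ((gridInsertion n R).lo e)) (new e) → ∀ i j : ℕ, i ≤ 2 * n → j ≤ n →
      (e.col / 2 < i ∨ e.row < j) →
      (restrict c).r (pt (max (e.col / 2) i) (max e.row j))
        (pt (max ((e.col + 1) / 2) i) (max (e.row + 1) j)) := by
    intro h i j hi hj hij
    rw [← pt_sup, ← pt_sup]
    refine rel_sup_of_rel_lower (x := new e) h ?_
    simp only [lower_new, lo_eq, Grid.le_iff, pt_fst, pt_snd]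
    omega
  have hinf : c.r (new e) (base ((gridInsertion n R).hi e)) → ∀ i j : ℕ, i ≤ 2 * n → j ≤ n →
      (i < (e.col + 1) / 2 ∨ j < e.row + 1) →
      (restrict c).r (pt (min (e.col / 2) i) (min e.row j))
        (pt (min ((e.col + 1) / 2) i) (min (e.row + 1) j)) := by
    intro h i j hi hj hij
    rw [← pt_inf, ← pt_inf]
    refine rel_inf_of_rel_upper (x := new e) h ?_
    simp only [upper_new, hi_eq, Grid.le_iff, pt_fst, pt_snd]
    omega
  rcases e.spec with ⟨hodd, -⟩ | ⟨heven, -⟩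
  · have hcol : (e.col + 1) / 2 = e.col / 2 + 1 := by omega
    rw [hcol] at hsup hinf ⊢
    rcases h with h | h
    · have h₁ := hsup h (e.col / 2 + 1) 0 (by omega) (by omega) (by omega)
      have h₂ := hsup h 0 (e.row + 1) (by omega) (by omega) (by omega)
      simp only [Nat.max_zero, max_self, max_eq_right (Nat.le_succ _)] at h₁ h₂
      rw [rel_horizontal_iff, ← rel_horizontal_iff _ _ e.row] at h₂
      exact (restrict c).trans h₂ h₁
    · have h₁ := hinf h (e.col / 2) (e.row + 1) (by omega) (by omega) (by omega)
      have h₂ := hinf h (e.col / 2 + 1) e.row (by omega) (by omega) (by omega)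
      simp only [min_self, min_eq_left (Nat.le_succ _), min_eq_right (Nat.le_succ _)] at h₁ h₂
      rw [rel_horizontal_iff, ← rel_horizontal_iff _ _ (e.row + 1)] at h₂
      exact (restrict c).trans h₁ h₂
  · have hcol : (e.col + 1) / 2 = e.col / 2 := by omega
    rw [hcol] at hsup hinf ⊢
    rw [rel_vertical_iff]
    rcases h with h | h
    · have h₁ := hsup h (e.col / 2 + 1) 0 (by omega) (by omega) (by omega)
      simp only [Nat.max_zero, max_eq_right (Nat.le_succ _)] at h₁
      rwa [rel_vertical_iff] at h₁
    · have h₁ := hinf h (e.col / 2 - 1) (e.row + 1) (by omega) (by omega) (by omega)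
      simp only [min_self, min_eq_left (Nat.le_succ _), min_eq_right (Nat.sub_le _ _)] at h₁
      rwa [rel_vertical_iff] at h₁

theorem edges_of_rel_lo_hi {k j : ℕ}
    (h : (restrict c).r (pt k j) (pt (k + 1) (j + 1))) :
    (restrict c).r (pt k 0) (pt (k + 1) 0) ∧ (restrict c).r (pt 0 j) (pt 0 (j + 1)) := by
  rw [rel_pt_of_le _ k.le_succ j.le_succ] at h
  exact ⟨h.1 k le_rfl k.lt_succ_self, h.2 j le_rfl j.lt_succ_self⟩

/-- A horizontal edge generates the same congruence as the vertical edge of its colour. -/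
theorem horizontal_iff_vertical {k : ℕ} (hk : k < 2 * n) :
    (restrict c).r (pt k 0) (pt (k + 1) 0) ↔
      (restrict c).r (pt 0 (k / 2)) (pt 0 (k / 2 + 1)) := by
  have hcell := restrict_lo_hi c (NewElt.cell R hk)
  have hlo : (gridInsertion n R).lo (NewElt.cell R hk) = pt k (k / 2) := by
    simp only [lo_eq, NewElt.col_cell, NewElt.row_cell]
    rw [(by omega : (2 * k + 1) / 2 = k)]
  have hhi : (gridInsertion n R).hi (NewElt.cell R hk) = pt (k + 1) (k / 2 + 1) := by
    simp only [hi_eq, NewElt.col_cell, NewElt.row_cell]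
    rw [(by omega : (2 * k + 1 + 1) / 2 = k + 1)]
  rw [← lo_eq, ← hi_eq, hlo, hhi] at hcell
  -- Joined with the new element, the lower corner gives the new element itself, while any point of
  -- the cell not below that corner gives the upper corner.
  have key : ∀ i j : ℕ, i ≤ k + 1 → j ≤ k / 2 + 1 → k < i ∨ k / 2 < j →
      (restrict c).r (pt k (k / 2)) (pt i j) →
      c.r (new (NewElt.cell R hk)) (base (pt (k + 1) (k / 2 + 1))) := by
    intro i j hi hj hij h
    have h' := c.sup (c.refl (new (NewElt.cell R hk))) h
    rw [sup_eq_left.2 (base_le_iff.2 hlo.ge), sup_base_of_not_le, upper_new, hhi, pt_sup,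
      max_eq_left hi, max_eq_left hj] at h'
    · exact h'
    · rw [lower_new, hlo, Grid.le_iff]
      simp only [pt_fst, pt_snd]
      omega
  constructor
  · intro h
    rw [← rel_horizontal_iff _ _ (k / 2)] at h
    exact (edges_of_rel_lo_hi c (hcell (Or.inr (key _ _ le_rfl (by omega) (by omega) h)))).2
  · intro h
    rw [← rel_vertical_iff _ k] at h
    exact (edges_of_rel_lo_hi c (hcell (Or.inr (key _ _ (by omega) le_rfl (by omega) h)))).1

/-- Column `2 * i` is collapsed along with colour `i`. Meeting its edge at height `j + 1` with the
new element on line `2 * i + 1` identifies that element with its lower neighbour, and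
`restrict_lo_hi` collapses the full edge of row `j`. -/
theorem vertical_of_rel {i j : ℕ} (hi : i < n) (hj : j < n) (hR : R j i)
    (h : (restrict c).r (pt 0 i) (pt 0 (i + 1))) : (restrict c).r (pt 0 j) (pt 0 (j + 1)) := by
  have hline := restrict_lo_hi c (NewElt.line hi hj hR)
  have hlo : (gridInsertion n R).lo (NewElt.line hi hj hR) = pt (2 * i + 1) j := by
    simp only [lo_eq, NewElt.col_line, NewElt.row_line]
    rw [(by omega : (4 * i + 2) / 2 = 2 * i + 1)]
  have hhi : (gridInsertion n R).hi (NewElt.line hi hj hR) = pt (2 * i + 1) (j + 1) := by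
    simp only [hi_eq, NewElt.col_line, NewElt.row_line]
    rw [(by omega : (4 * i + 2 + 1) / 2 = 2 * i + 1)]
  rw [← lo_eq, ← hi_eq, hlo, hhi, rel_vertical_iff] at hline
  refine hline (Or.inl ?_)
  have hH : (restrict c).r (pt (2 * i) (j + 1)) (pt (2 * i + 1) (j + 1)) := by
    rw [rel_horizontal_iff, horizontal_iff_vertical c (by omega)]
    rwa [(by omega : 2 * i / 2 = i)]
  have h' := c.inf (c.refl (new (NewElt.line hi hj hR))) hH
  rw [inf_eq_left.2 (le_base_iff.2 hhi.le : new (NewElt.line hi hj hR) ≤ _), inf_base_of_not_le,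
    lower_new, hlo, pt_inf, min_eq_right (Nat.le_succ _), min_eq_left (Nat.le_succ _)] at h'
  · refine c.rel_right_of_le (base_le_base.2 (pt_mono (Nat.le_succ _) le_rfl)) ?_ h'
    exact base_le_iff.2 hlo.ge
  · rw [upper_new, hhi, Grid.le_iff]
    simp only [pt_fst, pt_snd]
    omega

theorem toCon_surjective : Function.Surjective (toCon (n := n) (R := R)) := by
  intro c
  let S : ClosedSet n R := ⟨{j | (restrict c).r (pt 0 j) (pt 0 (j + 1))},
    fun i j hR hi => vertical_of_rel c i.2 j.2 hR hi⟩
  have hV : ∀ j, Mem S j ↔ (restrict c).r (pt 0 j) (pt 0 (j + 1)) := by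
    intro j
    refine ⟨fun h => ?_, fun h _ => h⟩
    by_cases hj : j < n
    · exact h hj
    -- Beyond the grid the cut-off makes both ends equal, matching the convention that non-colours
    -- are members.
    · have : (pt 0 j : Grid (2 * n) n) = pt 0 (j + 1) := ext_val (by simp) (by simp; omega)
      rw [this]
  have hH : ∀ k, Mem S (k / 2) ↔ (restrict c).r (pt k 0) (pt (k + 1) 0) := by
    intro k
    by_cases hk : k < 2 * n
    · rw [hV, horizontal_iff_vertical c hk]
    · have : (pt k 0 : Grid (2 * n) n) = pt (k + 1) 0 := ext_val (by simp; omega) (by simp)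
      rw [this]
      exact iff_of_true (fun h => by omega) ((restrict c).refl _)
  have hS : ∀ x y, (gridCon S).r x y ↔ (restrict c).r x y := by
    intro x y
    rw [Grid.rel_iff (restrict c), gridCon, funext fun k => propext (hH k),
      funext fun j => propext (hV j)]
  have hc := rel_iff_extRel_restrict c fun e h => restrict_lo_hi c e h
  refine ⟨S, le_antisymm (fun x y h => (hc x y).2 ?_) fun x y h => ?_⟩
  · exact h.imp id fun ⟨g, hx, hy⟩ =>
      ⟨g, ⟨(hS _ _).1 hx.1, (hS _ _).1 hx.2⟩, ⟨(hS _ _).1 hy.1, (hS _ _).1 hy.2⟩⟩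
  · exact ((hc x y).1 h).imp id fun ⟨g, hx, hy⟩ =>
      ⟨g, ⟨(hS _ _).2 hx.1, (hS _ _).2 hx.2⟩, ⟨(hS _ _).2 hy.1, (hS _ _).2 hy.2⟩⟩

/-- The congruences of the lattice correspond to the sets of colours closed under `R`. -/
noncomputable def closedSetIso (n : ℕ) (R : ℕ → ℕ → Prop) :
    ClosedSet n R ≃o LatticeCon (GridLattice n R) :=
  RelIso.ofSurjective (OrderEmbedding.ofMapLEIff toCon toCon_le_iff) toCon_surjective

end GridLattice

/-! ### The theorem -/

theorem theoremT :
    ∃ C : ℕ, ∀ (D : Type*) [DistribLattice D] [Finite D] [Nonempty D],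
      ∃ (L : Type) (_ : Lattice L),
        Finite L ∧ Nonempty L ∧ IsPlanarLattice L ∧
        Nonempty (LatticeCon L ≃o D) ∧
        (0 < numJoinIrred D → Nat.card L ≤ C * numJoinIrred D ^ 2) := by
  classical
  refine ⟨10, fun D _ _ _ => ?_⟩
  have := Fintype.ofFinite D
  let _ : OrderBot D := Fintype.toOrderBot D
  let e : {a : D // SupIrred a} ≃ Fin (numJoinIrred D) := Finite.equivFin _
  -- The order of the join-irreducibles, transported to indices, so that closed sets are exactly
  -- lower sets.
  let R : ℕ → ℕ → Prop := fun j i => ∃ hj hi, e.symm ⟨j, hj⟩ ≤ e.symm ⟨i, hi⟩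
  let f : LowerSet {a : D // SupIrred a} ≃o GridLattice.ClosedSet (numJoinIrred D) R :=
    { toFun := fun s => ⟨{i | e.symm i ∈ s}, fun i j ⟨_, _, h⟩ hi => s.lower h hi⟩
      invFun := fun S => ⟨{a | e a ∈ S.1}, fun a b h ha =>
        S.2 (e a) (e b) ⟨(e b).2, (e a).2, by simpa using h⟩ ha⟩
      left_inv := fun s => by ext a; simp
      right_inv := fun S => by
        ext i
        change e (e.symm i) ∈ S.1 ↔ i ∈ S.1
        rw [e.apply_symm_apply]
      map_rel_iff' := fun {s t} => ⟨fun h a ha => by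
        simpa using h (show e a ∈ {i | e.symm i ∈ s} by simpa using ha), fun h i hi => h hi⟩ }
  exact ⟨GridLattice (numJoinIrred D) R, inferInstance, inferInstance, inferInstance,
    GridLattice.isPlanarLattice,
    ⟨((OrderIso.lowerSetSupIrred.trans f).trans (GridLattice.closedSetIso _ R)).symm⟩,
    GridLattice.card_le⟩
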